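/- **Conventions.** $C(u\mid v)$ is (plain) conditional Kolmogorov complexity of binary strings with respect to a fixed optimal decompressor, $C(u)=C(u\mid\text{empty string})$; a pair $\langle u,v\rangle$ of strings is coded by a string in a fixed computable way, $C(u,v)=C(\langle u,v\rangle)$, and $I(u:v\mid z)=C(v\mid z)-C(v\mid u,z)$. Logarithms are binary. A term $O(\log N)$, with $N$ the total length of the strings involved, means a quantity at most $c\log(N+2)$ in absolute value, for a constant $c$ as specified. **Graphs.** Let $d\ge 1$ and $q$ be natural numbers, and put $n=\log q$. Let $G=(L,R;E)$ be a finite bipartite graph, $E\subseteq L\times R$, whose vertices are binary strings, such that (a) $|L|=q^2$, $|R|=q^{d+1}$, every vertex in $R$ has degree $q$ and every vertex in $L$ has degree $q^d$; (b) any two distinct vertices of $R$ have at most $d$ common neighbours in $L$; (c) $G$ is given explicitly: a fixed algorithm $A$, on input $(\lfloor n\rfloor,d)$ (that is, $(n,d)$ if $q=2^n$), outputs the complete list of vertices and edges of $G$. For $m\ge 0$ let $\bar G=(\bar L,\bar R;\bar E)$ be the $m$-private randomness amplification of $G$: $\bar L=L\times\{0,1\}^m$, $\bar R=R\times\{0,1\}^m$,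 and $(\langle x,r_x\rangle,\langle y,r_y\rangle)\in\bar E$ if and only if $(x,y)\in E$. For a constant $c_0$, an edge $(\bar x,\bar y)=(\langle x,r_x\rangle,\langle y,r_y\rangle)\in\bar E$ is called *typical* if $$C(\bar x)=2n+m,\qquad C(\bar y)=(d+1)n+m,\qquad C(\bar x,\bar y)=(d+2)n+2m,$$ each up to an additive error of absolute value at most $c_0\log(N_0+2)$, where $N_0=|x|+|y|+2m$. **Theorem.** For every algorithm $A$ and every constant $c_0$ there is a constant $c$ (depending only on $A$, $c_0$ and the optimal decompressor) such that for all $q,d,m,G$ as above, every typical edge $(\bar x,\bar y)=(\langle x,r_x\rangle,\langle y,r_y\rangle)$ of $\bar G$ and every binary string $w$, with $N=|x|+|y|+2m+|w|$, at least one of the following holds: $$C(y\mid x)\le I(w:\bar y\mid\bar x)+c\log(N+2)$$ or $$C(x\mid y)\le I(\bar x:\bar y\mid w)+I(w:\bar x\mid\bar y)+\log d+c\log(N+2).$$ -/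

import Mathlib

/-! ### Strings and Kolmogorov complexity -/

/-- Binary strings. -/
abbrev Str := List Bool

namespace Kolmogorov

/-- Self-delimiting code of a pair of strings: every bit of `x` is doubled, then the
separator `01`, then `y`. -/
def pair (x y : Str) : Str := (x.flatMap fun b => [b, b]) ++ [false, true] ++ y

/-- `U p y` is the (possibly undefined) output of the conditional decompressor `U` on the
description `p` and the condition `y`. It is optimal if it is partial computable and
every partial computable decompressor can be replaced by `U` at the cost of
a constant number of additional bits. -/
def IsOptimal (U : Str → Str →. Str) : Prop :=
  Partrec₂ U ∧ ∀ V : Str → Str →. Str, Partrec₂ V →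
    ∃ c : ℕ, ∀ p x y : Str, x ∈ V p y → ∃ p' : Str, x ∈ U p' y ∧ p'.length ≤ p.length + c

/-- Conditional Kolmogorov complexity `C(x|y)` with respect to the decompressor `U`: the length
of a shortest description of `x` given `y` (for an optimal `U` a description always exists). -/
noncomputable def condC (U : Str → Str →. Str) (x y : Str) : ℕ :=
  sInf {k : ℕ | ∃ p : Str, x ∈ U p y ∧ p.length = k}

/-- Kolmogorov complexity `C(x)`: the condition is the empty string. -/
noncomputable def plainC (U : Str → Str →. Str) (x : Str) : ℕ := condC U x []

/-- `I(x:y|z) = C(y|z) - C(y|x,z)`. -/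
noncomputable def condInfo (U : Str → Str →. Str) (x y z : Str) : ℝ :=
  (condC U y z : ℝ) - (condC U y (pair x z) : ℝ)

/-- The logarithmic scale `log₂ N`, shifted to `log₂ (N + 2)` to stay positive at `N = 0, 1`. -/
noncomputable def logScale (N : ℕ) : ℝ := Real.logb 2 ((N : ℝ) + 2)

end Kolmogorov

/-! ### Bipartite graphs -/

/-- A finite bipartite graph `(L, R; E)` with `E ⊆ L × R`. -/
structure BipartiteGraph (α β : Type) where
  left : Finset α
  right : Finset β
  edges : Finset (α × β)
  edges_subset : edges ⊆ left ×ˢ right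

namespace BipartiteGraph

variable {α β : Type} [DecidableEq α] [DecidableEq β]

/-- `|L| = q²`, `|R| = q^(d+1)`, every right vertex has degree `q` and every left vertex has
degree `q^d`. -/
def HasProfile (G : BipartiteGraph α β) (q d : ℕ) : Prop :=
  G.left.card = q ^ 2 ∧ G.right.card = q ^ (d + 1) ∧
  (∀ y ∈ G.right, (G.left.filter fun x => (x, y) ∈ G.edges).card = q) ∧
  (∀ x ∈ G.left, (G.right.filter fun y => (x, y) ∈ G.edges).card = q ^ d)

/-- Any two distinct right vertices have at most `d` common neighbours. -/
def BoundedCommonNeighborhoodRight (G : BipartiteGraph α β) (d : ℕ) : Prop :=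
  ∀ v₁ ∈ G.right, ∀ v₂ ∈ G.right, v₁ ≠ v₂ →
    (G.left.filter fun x => (x, v₁) ∈ G.edges ∧ (x, v₂) ∈ G.edges).card ≤ d

/-- The `m`-private randomness amplification: vertices get an additional component in `{0,1}^m`,
and adjacency depends only on the original components. -/
def amplify (G : BipartiteGraph α β) (m : ℕ) :
    BipartiteGraph (α × List.Vector Bool m) (β × List.Vector Bool m) where
  left := G.left ×ˢ Finset.univ
  right := G.right ×ˢ Finset.univ
  edges := ((G.left ×ˢ Finset.univ) ×ˢ (G.right ×ˢ Finset.univ)).filter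
    fun e => (e.1.1, e.2.1) ∈ G.edges
  edges_subset := Finset.filter_subset _ _

/-- The complete list of vertices and edges of the graph is `l`. -/
def IsListedBy (G : BipartiteGraph α β) (l : List α × List β × List (α × β)) : Prop :=
  l.1.toFinset = G.left ∧ l.2.1.toFinset = G.right ∧ l.2.2.toFinset = G.edges

end BipartiteGraph

/-! ### Typical edges of the amplified graph -/

namespace Kolmogorov

/-- The string `⟨x, r⟩` that represents a vertex of an amplified graph. -/
def vertexCode {m : ℕ} (v : Str × List.Vector Bool m) : Str := pair v.1 v.2.toList

/-- Total length of the components of a vertex of an amplified graph. -/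
def vertexLength {m : ℕ} (v : Str × List.Vector Bool m) : ℕ := v.1.length + m

/-- `(x̄, ȳ)` is an edge of the `m`-amplification of `G` (a graph with profile `q, d`) such that,
with `n = log₂ q`,
`C(x̄) = 2n + m`, `C(ȳ) = (d+1)n + m` and `C(x̄, ȳ) = (d+2)n + 2m`, up to `c₀ log N`,
where `N` is the total length of the strings involved. -/
def IsTypicalEdge (U : Str → Str →. Str) (c₀ : ℝ) (G : BipartiteGraph Str Str) (q d m : ℕ)
    (xb yb : Str × List.Vector Bool m) : Prop :=
  (xb, yb) ∈ (G.amplify m).edges ∧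
  |(plainC U (vertexCode xb) : ℝ) - (2 * Real.logb 2 q + m)|
    ≤ c₀ * logScale (vertexLength xb + vertexLength yb) ∧
  |(plainC U (vertexCode yb) : ℝ) - ((d + 1) * Real.logb 2 q + m)|
    ≤ c₀ * logScale (vertexLength xb + vertexLength yb) ∧
  |(plainC U (pair (vertexCode xb) (vertexCode yb)) : ℝ) - ((d + 2) * Real.logb 2 q + 2 * m)|
    ≤ c₀ * logScale (vertexLength xb + vertexLength yb)

end Kolmogorov

/-! Write X, Y for the codes of the two endpoints and n = log q; all estimates below are up to O(log
N). Let S be the set of strings of complexity at most C(Y|w) given w, and let X have about 2^j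
neighbours in S. These neighbours can be enumerated from X and w, so C(Y|X,w) is at most about j.

If j ≤ m, then w and X leave only m bits of Y undetermined, while typicality gives C(Y|X) ≥ dn + m.
Hence I(w:Y|X) ≥ dn, and dn bounds C(y|x) because left vertices have degree q^d.

If j > m, at least half of the neighbours of X in S differ in their graph component from any given
one. Two right vertices with distinct graph components have at most d·2^m common neighbours, so
double counting leaves at most about |S|²·d·2^m / 2^(2j) vertices with 2^j neighbours in S. As X is
one of them, C(X|w) + 2C(Y|X,w) ≤ 2C(Y|w) + m + log d. Symmetry of information eliminates C(X|w),
and C(X|Y) ≥ n + m by typicality; the sum I(X:Y|w) + I(w:X|Y) is therefore at least n - log d, while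
C(x|y) ≤ n.

Cardinality bounds become complexity bounds through `IsOptimal.condC_le_of_card_le`. The number j
comes from `IsOptimal.exists_slice_size`, which also yields symmetry of information; the double
counting is `card_mul_two_pow_le`, and the dichotomy is `IsOptimal.condC_le_or_condC_le`. The case q
= 1 is separate, since typicality then gives no bound on d. -/

/-! ### Semidecidable predicates -/

/-- A predicate is semidecidable if it is a projection of a primitive recursive relation. -/
def Semidecidable {α : Type*} [Primcodable α] (P : α → Prop) : Prop :=
  ∃ R : α → ℕ → Prop, PrimrecRel R ∧ ∀ a, P a ↔ ∃ t, R a t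

namespace Semidecidable

variable {α β : Type*} [Primcodable α] [Primcodable β]

theorem of_primrecPred {P : α → Prop} (h : PrimrecPred P) : Semidecidable P :=
  ⟨fun a _ => P a, h.comp Primrec.fst, fun a => by simp⟩

theorem of_iff {P Q : α → Prop} (h : Semidecidable P) (H : ∀ a, Q a ↔ P a) : Semidecidable Q := by
  obtain ⟨R, hR, hP⟩ := h
  exact ⟨R, hR, fun a => (H a).trans (hP a)⟩

theorem comp {P : β → Prop} (h : Semidecidable P) {f : α → β} (hf : Primrec f) :
    Semidecidable fun a => P (f a) := by
  obtain ⟨R, hR, hP⟩ := h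
  exact ⟨fun a t => R (f a) t, PrimrecRel.comp hR (hf.comp Primrec.fst) Primrec.snd,
    fun a => hP (f a)⟩

theorem and {P Q : α → Prop} (hP : Semidecidable P) (hQ : Semidecidable Q) :
    Semidecidable fun a => P a ∧ Q a := by
  obtain ⟨R, hR, hP⟩ := hP
  obtain ⟨S, hS, hQ⟩ := hQ
  refine ⟨fun a t => R a t.unpair.1 ∧ S a t.unpair.2, ?_, fun a => ?_⟩
  · exact (PrimrecRel.comp hR Primrec.fst
      (Primrec.fst.comp (Primrec.unpair.comp Primrec.snd))).and
      (PrimrecRel.comp hS Primrec.fst (Primrec.snd.comp (Primrec.unpair.comp Primrec.snd)))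
  · simp only [hP, hQ]
    constructor
    · rintro ⟨⟨s, hs⟩, ⟨t, ht⟩⟩
      exact ⟨Nat.pair s t, by simpa using ⟨hs, ht⟩⟩
    · rintro ⟨t, h1, h2⟩
      exact ⟨⟨_, h1⟩, ⟨_, h2⟩⟩

theorem ex {P : α × β → Prop} (h : Semidecidable P) : Semidecidable fun a => ∃ b, P (a, b) := by
  obtain ⟨R, hR, hP⟩ := h
  refine ⟨fun a t => ∃ b ∈ (Encodable.decode t.unpair.1 : Option β).toList,
    R (a, b) t.unpair.2, ?_, fun a => ?_⟩
  · have h1 : PrimrecRel fun (b : β) (p : α × ℕ) => R (p.1, b) p.2.unpair.2 :=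
      PrimrecRel.comp hR ((Primrec.fst.comp Primrec.snd).pair Primrec.fst)
        (Primrec.snd.comp (Primrec.unpair.comp (Primrec.snd.comp Primrec.snd)))
    exact PrimrecRel.comp h1.exists_mem_list
      (Primrec.optionToList.comp
        (Primrec.decode.comp (Primrec.fst.comp (Primrec.unpair.comp Primrec.snd)))) Primrec.id
  · simp only [hP]
    constructor
    · rintro ⟨b, t, h⟩
      exact ⟨Nat.pair (Encodable.encode b) t, b, by simp, by simpa using h⟩
    · rintro ⟨t, b, -, h⟩
      exact ⟨b, _, h⟩

theorem exists_lt_of_primrecRel {R : ℕ → α → Prop} (h : PrimrecRel R) :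
    PrimrecRel fun (n : ℕ) (a : α) => ∃ i < n, R i a := by
  have h' : PrimrecRel fun (n : ℕ) (a : α) => ∃ i ∈ List.range n, R i a :=
    PrimrecRel.comp h.exists_mem_list (Primrec.list_range.comp Primrec.fst) Primrec.snd
  exact h'.of_eq fun n a => by simp

theorem forall_lt_of_primrecRel {R : ℕ → α → Prop} (h : PrimrecRel R) :
    PrimrecRel fun (n : ℕ) (a : α) => ∀ i < n, R i a := by
  have h' : PrimrecRel fun (n : ℕ) (a : α) => ∀ i ∈ List.range n, R i a :=
    PrimrecRel.comp h.forall_mem_list (Primrec.list_range.comp Primrec.fst) Primrec.snd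
  exact h'.of_eq fun n a => by simp

/-- The witnesses for the finitely many elements have a common bound `T`, and a search below `T` is
primitive recursive. -/
theorem forall_mem_list {P : α × β → Prop} (h : Semidecidable P) :
    Semidecidable fun q : α × List β => ∀ b ∈ q.2, P (q.1, b) := by
  obtain ⟨R, hR, hP⟩ := h
  refine ⟨fun q T => ∀ b ∈ q.2, ∃ t < T, R (q.1, b) t, ?_, fun q => ?_⟩
  · have h1 : PrimrecRel fun (t : ℕ) (p : α × β) => R p t := hR.swap
    have h1' := exists_lt_of_primrecRel h1
    have h2 : PrimrecRel fun (b : β) (p : α × ℕ) => ∃ t < p.2, R (p.1, b) t :=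
      PrimrecRel.comp h1' (Primrec.snd.comp Primrec.snd)
        ((Primrec.fst.comp Primrec.snd).pair Primrec.fst)
    exact PrimrecRel.comp h2.forall_mem_list (Primrec.snd.comp Primrec.fst)
      ((Primrec.fst.comp Primrec.fst).pair Primrec.snd)
  · simp only [hP]
    obtain ⟨a, l⟩ := q
    constructor
    · intro h
      induction l with
      | nil => exact ⟨0, by simp⟩
      | cons b l ih =>
        obtain ⟨T, hT⟩ := ih fun b hb => h b (List.mem_cons_of_mem _ hb)
        obtain ⟨t, ht⟩ := h b List.mem_cons_self
        refine ⟨max T (t + 1), fun b' hb' => ?_⟩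
        rcases List.mem_cons.1 hb' with rfl | hb'
        · exact ⟨t, by simp, ht⟩
        · obtain ⟨s, hs, h⟩ := hT b' hb'
          exact ⟨s, by simp [hs], h⟩
    · rintro ⟨T, h⟩ b hb
      obtain ⟨t, -, ht⟩ := h b hb
      exact ⟨t, ht⟩

/-- The graph of a partial computable function is semidecidable. -/
theorem of_partrec {f : α →. β} (hf : Partrec f) : Semidecidable fun p : α × β => p.2 ∈ f p.1 := by
  obtain ⟨c, hc⟩ := Nat.Partrec.Code.exists_code.1 hf
  refine ⟨fun p k => Nat.Partrec.Code.evaln k c (Encodable.encode p.1) = some (Encodable.encode p.2),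
    ?_, fun p => ?_⟩
  · refine PrimrecRel.comp Primrec.eq ?_ ?_
    · exact Nat.Partrec.Code.primrec_evaln.comp
        ((Primrec.snd.pair (Primrec.const c)).pair
          (Primrec.encode.comp (Primrec.fst.comp Primrec.fst)))
    · exact Primrec.option_some.comp (Primrec.encode.comp (Primrec.snd.comp Primrec.fst))
  · have := @Nat.Partrec.Code.evaln_complete c (Encodable.encode p.1) (Encodable.encode p.2)
    simp only [Option.mem_def] at this
    rw [← this, hc]
    simp

/-- The sections of a semidecidable relation can be enumerated. -/
theorem exists_enumeration {P : α × β → Prop} (h : Semidecidable P) :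
    ∃ g : α → ℕ → Option β, Primrec₂ g ∧ ∀ a b, P (a, b) ↔ ∃ t, g a t = some b := by
  obtain ⟨R, hR, hP⟩ := h
  classical
  refine ⟨fun a t => (Encodable.decode t.unpair.1 : Option β).bind fun b =>
    if R (a, b) t.unpair.2 then some b else none, ?_, fun a b => ?_⟩
  · refine Primrec.option_bind
      (Primrec.decode.comp (Primrec.fst.comp (Primrec.unpair.comp Primrec.snd))) ?_
    refine Primrec.ite (PrimrecRel.comp hR
      ((Primrec.fst.comp Primrec.fst).pair Primrec.snd)
      (Primrec.snd.comp (Primrec.unpair.comp (Primrec.snd.comp Primrec.fst)))) ?_ ?_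
    · exact Primrec.option_some.comp Primrec.snd
    · exact Primrec.const none
  · rw [hP]
    constructor
    · rintro ⟨t, ht⟩
      exact ⟨Nat.pair (Encodable.encode b) t, by simp [ht]⟩
    · rintro ⟨t, hb⟩
      simp only [Option.bind_eq_some_iff] at hb
      obtain ⟨b', -, hb⟩ := hb
      split_ifs at hb with hc
      cases hb
      exact ⟨_, hc⟩

/-- A semidecidable relation that is single-valued is the graph of a partial computable
function. -/
theorem exists_partrec {P : α × β → Prop} (h : Semidecidable P)
    (hu : ∀ a b b', P (a, b) → P (a, b') → b = b') :
    ∃ f : α →. β, Partrec f ∧ ∀ a b, P (a, b) → b ∈ f a := by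
  obtain ⟨g, hg, hP⟩ := h.exists_enumeration
  refine ⟨fun a => Nat.rfindOpt (g a), Partrec.rfindOpt hg.to_comp, fun a b hb => ?_⟩
  obtain ⟨t, ht⟩ := (hP _ _).1 hb
  have hdom : (Nat.rfindOpt (g a)).Dom := Nat.rfindOpt_dom.2 ⟨t, b, ht⟩
  obtain ⟨t', ht'⟩ := Nat.rfindOpt_spec ⟨hdom, rfl⟩
  have := hu _ _ _ hb ((hP _ _).2 ⟨t', ht'⟩)
  rw [this]
  exact ⟨hdom, rfl⟩

/-- The elements of the sections of a semidecidable relation can be numbered, in a semidecidable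
way, in the order of their appearance in an enumeration. -/
theorem exists_numbering {P : α × β → Prop} (h : Semidecidable P) :
    ∃ Q : (α × ℕ) × β → Prop, Semidecidable Q ∧
      (∀ a i b b', Q ((a, i), b) → Q ((a, i), b') → b = b') ∧
      ∀ a b M, P (a, b) → (∀ F : Finset β, (∀ b ∈ F, P (a, b)) → F.card ≤ M) →
        ∃ i < M, Q ((a, i), b) := by
  obtain ⟨g, hg, hP⟩ := h.exists_enumeration
  classical
  -- `N s a` marks the stages at which a new element appears; the number of an element is the count
  -- of such stages before its own.
  let N : ℕ → α → Prop := fun s a => g a s ≠ none ∧ ∀ r < s, g a r ≠ g a s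
  have hN : PrimrecRel N := by
    refine PrimrecPred.and (PrimrecRel.comp Primrec.eq.not
      (hg.comp Primrec.snd Primrec.fst) (Primrec.const none)) ?_
    have h1 : PrimrecRel fun (r : ℕ) (p : ℕ × α) => g p.2 r ≠ g p.2 p.1 :=
      PrimrecRel.comp Primrec.eq.not (hg.comp (Primrec.snd.comp Primrec.snd) Primrec.fst)
        (hg.comp (Primrec.snd.comp Primrec.snd) (Primrec.fst.comp Primrec.snd))
    have h1' := forall_lt_of_primrecRel h1
    exact PrimrecRel.comp h1' Primrec.fst Primrec.id
  have hcount : Primrec₂ fun (t : ℕ) (a : α) => Nat.count (N · a) t := by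
    have h2 := hN.listFilter
    have h3 : Primrec₂ fun (t : ℕ) (a : α) => ((List.range t).filter (N · a)).length :=
      Primrec.list_length.comp
        (h2.comp (Primrec.list_range.comp Primrec.fst) Primrec.snd)
    refine h3.of_eq fun t a => ?_
    rw [Nat.count, List.countP_eq_length_filter]
  refine ⟨fun q => ∃ t, g q.1.1 t = some q.2 ∧ N t q.1.1 ∧ Nat.count (N · q.1.1) t = q.1.2,
    ⟨_, ?_, fun _ => Iff.rfl⟩, ?_, ?_⟩
  · have e1 : Primrec fun p : ((α × ℕ) × β) × ℕ => p.1.1.1 :=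
      Primrec.fst.comp (Primrec.fst.comp Primrec.fst)
    refine PrimrecPred.and (PrimrecRel.comp Primrec.eq (hg.comp e1 Primrec.snd)
      (Primrec.option_some.comp (Primrec.snd.comp Primrec.fst))) (PrimrecPred.and ?_ ?_)
    · exact PrimrecRel.comp hN Primrec.snd e1
    · exact PrimrecRel.comp Primrec.eq (hcount.comp Primrec.snd e1)
        (Primrec.snd.comp (Primrec.fst.comp Primrec.fst))
  · rintro a i b b' ⟨t, h1, h2, h3⟩ ⟨t', h1', h2', h3'⟩
    simp only at h1 h2 h3 h1' h2' h3'
    have : t = t' := Nat.count_injective h2 h2' (h3.trans h3'.symm)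
    subst this
    rw [h1] at h1'
    exact Option.some.inj h1'
  · intro a b M hb hM
    have hex : ∃ t, g a t = some b := (hP _ _).1 hb
    let t := Nat.find hex
    have ht : g a t = some b := Nat.find_spec hex
    have hnew : N t a := by
      refine ⟨by simp [ht], fun r hr => ?_⟩
      rw [ht]
      exact Nat.find_min hex hr
    refine ⟨Nat.count (N · a) t, ?_, t, ht, hnew, rfl⟩
    -- Marked stages yield distinct elements of the section. Counting stage `t` itself is what makes
    -- the index strictly smaller than `M`.
    have hcard : Nat.count (N · a) (t + 1) ≤ M := by
      rw [Nat.count_eq_card_filter_range]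
      set T := (Finset.range (t + 1)).filter (N · a)
      let φ : ℕ → β := fun s => (g a s).getD b
      have hφ : ∀ s ∈ T, g a s = some (φ s) := by
        intro s hs
        obtain ⟨c, hc⟩ := Option.ne_none_iff_exists'.1 (Finset.mem_filter.1 hs).2.1
        simp [φ, hc]
      have hinj : Set.InjOn φ T := by
        intro s hs s' hs' he
        have e : g a s = g a s' := by rw [hφ s hs, hφ s' hs', he]
        rcases lt_trichotomy s s' with hlt | heq | hlt
        · exact absurd e ((Finset.mem_filter.1 hs').2.2 s hlt)
        · exact heq
        · exact absurd e.symm ((Finset.mem_filter.1 hs).2.2 s' hlt)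
      rw [← Finset.card_image_of_injOn hinj]
      refine hM _ fun c hc => ?_
      obtain ⟨s, hs, rfl⟩ := Finset.mem_image.1 hc
      exact (hP _ _).2 ⟨s, hφ s hs⟩
    rw [Nat.count_succ, if_pos hnew] at hcard
    omega

/-- "At least `M` elements of a section of a semidecidable relation" is semidecidable. -/
theorem exists_card_le [DecidableEq β] {P : α × β → Prop} (h : Semidecidable P) {M : α → ℕ}
    (hM : Primrec M) :
    Semidecidable fun a => ∃ F : Finset β, M a ≤ F.card ∧ ∀ b ∈ F, P (a, b) := by
  -- Finite sets are searched for as duplicate-free lists; bounded quantifiers make the absence of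
  -- duplicates primitive recursive.
  have hnodup : PrimrecPred fun l : List β => ∀ i < l.length, ∀ j < i, l[i]? ≠ l[j]? := by
    have h1 : PrimrecRel fun (j : ℕ) (p : ℕ × List β) => p.2[p.1]? ≠ p.2[j]? :=
      PrimrecRel.comp Primrec.eq.not
        (Primrec.list_getElem?.comp (Primrec.snd.comp Primrec.snd) (Primrec.fst.comp Primrec.snd))
        (Primrec.list_getElem?.comp (Primrec.snd.comp Primrec.snd) Primrec.fst)
    have h1' := forall_lt_of_primrecRel h1
    have h2 : PrimrecRel fun (i : ℕ) (l : List β) => ∀ j < i, l[i]? ≠ l[j]? :=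
      PrimrecRel.comp h1' Primrec.fst Primrec.id
    exact PrimrecRel.comp (forall_lt_of_primrecRel h2) Primrec.list_length Primrec.id
  have hle : PrimrecPred fun q : α × List β => M q.1 ≤ q.2.length :=
    PrimrecRel.comp Primrec.nat_le (hM.comp Primrec.fst) (Primrec.list_length.comp Primrec.snd)
  refine (ex (((of_primrecPred (hnodup.comp Primrec.snd)).and (of_primrecPred hle)).and
    h.forall_mem_list)).of_iff fun a => ?_
  have key : ∀ l : List β, (∀ i < l.length, ∀ j < i, l[i]? ≠ l[j]?) ↔ l.Nodup := by
    intro l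
    rw [List.nodup_iff_getElem?_ne_getElem?]
    constructor
    · intro H i j hij hj
      exact (H j hj i hij).symm
    · intro H i hi j hj
      exact (H j i hj hi).symm
  constructor
  · rintro ⟨F, hF, hb⟩
    refine ⟨F.toList, ⟨(key _).2 F.nodup_toList, by simpa using hF⟩, by simpa using hb⟩
  · rintro ⟨l, ⟨h1, h2⟩, h3⟩
    refine ⟨l.toFinset, ?_, by simpa using h3⟩
    rw [List.toFinset_card_of_nodup ((key l).1 h1)]
    exact h2

end Semidecidable

namespace Kolmogorov

/-! ### Coding of pairs and numbers by strings -/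

theorem length_pair (x y : Str) : (pair x y).length = 2 * x.length + 2 + y.length := by
  have : ∀ x : Str, (x.flatMap fun b => [b, b]).length = 2 * x.length := by
    intro x
    induction x with
    | nil => rfl
    | cons b x ih => simp only [List.flatMap_cons, List.length_append, ih, List.length_cons,
        List.length_nil]; omega
  simp only [pair, List.length_append, this, List.length_cons, List.length_nil]

theorem pair_inj {x y x' y' : Str} : pair x y = pair x' y' ↔ x = x' ∧ y = y' := by
  refine ⟨fun h => ?_, by rintro ⟨rfl, rfl⟩; rfl⟩
  induction x generalizing x' with
  | nil =>
    cases x' with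
    | nil => simpa [pair] using h
    | cons b x' => cases b <;> simp [pair] at h
  | cons b x ih =>
    cases x' with
    | nil => cases b <;> simp [pair] at h
    | cons b' x' =>
      have h' : b = b' ∧ pair x y = pair x' y' := by
        simpa [pair] using h
      obtain ⟨h1, h2⟩ := ih h'.2
      exact ⟨by rw [h'.1, h1], h2⟩

theorem primrec_pair : Primrec₂ pair := by
  have h1 : Primrec₂ fun (_ : Str × Str) (b : Bool) => [b, b] :=
    Primrec.list_cons.comp Primrec.snd
      (Primrec.list_cons.comp Primrec.snd (Primrec.const []))
  exact Primrec.list_append.comp (Primrec.list_append.comp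
    (Primrec.list_flatMap Primrec.fst h1) (Primrec.const _)) Primrec.snd

/-- The number whose binary expansion, least significant bit first, is the given string. -/
def natOfBits (l : Str) : ℕ := l.foldr Nat.bit 0

theorem natOfBits_bits (n : ℕ) : natOfBits n.bits = n := by
  induction n using Nat.binaryRec' with
  | zero => simp [natOfBits]
  | bit b n h ih =>
    rw [Nat.bits_append_bit n b h]
    simp only [natOfBits, List.foldr_cons] at ih ⊢
    rw [ih]

theorem primrec_natOfBits : Primrec natOfBits := by
  have hbit : Primrec₂ Nat.bit := by
    refine (Primrec.cond Primrec.fst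
      (Primrec.succ.comp (Primrec.nat_mul.comp (Primrec.const 2) Primrec.snd))
      (Primrec.nat_mul.comp (Primrec.const 2) Primrec.snd)).of_eq ?_
    rintro ⟨b, n⟩
    cases b <;> rfl
  exact Primrec.list_foldr Primrec.id (Primrec.const 0)
    (hbit.comp (Primrec.fst.comp Primrec.snd) (Primrec.snd.comp Primrec.snd)).to₂

theorem size_pair_le {a b s : ℕ} (ha : a.size ≤ s) (hb : b.size ≤ s) :
    (Nat.pair a b).size ≤ 2 * s := by
  rw [Nat.size_le] at *
  calc Nat.pair a b < (max a b + 1) ^ 2 := Nat.pair_lt_max_add_one_sq a b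
    _ ≤ (2 ^ s) ^ 2 := Nat.pow_le_pow_left (by omega) 2
    _ = 2 ^ (2 * s) := by rw [← pow_mul, mul_comm]

theorem size_succ_le (n : ℕ) : (n + 1).size ≤ n.size + 1 := by
  rw [Nat.size_le, pow_succ]
  have := Nat.lt_size_self n
  omega

/-! ### Basic properties of the complexity function -/

section

variable {U : Str → Str →. Str}

theorem condC_le_of_mem {p x z : Str} (h : x ∈ U p z) : condC U x z ≤ p.length :=
  Nat.sInf_le ⟨p, h, rfl⟩

theorem IsOptimal.condC_le_length (hU : IsOptimal U) :
    ∃ c, ∀ x z : Str, (∃ p, x ∈ U p z) ∧ condC U x z ≤ x.length + c := by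
  obtain ⟨c, hc⟩ := hU.2 (fun p _ => Part.some p) (Computable.fst.partrec)
  refine ⟨c, fun x z => ?_⟩
  obtain ⟨p, hp, hl⟩ := hc x x z (Part.mem_some x)
  exact ⟨⟨p, hp⟩, (condC_le_of_mem hp).trans hl⟩

theorem IsOptimal.exists_description (hU : IsOptimal U) (x z : Str) :
    ∃ p, x ∈ U p z ∧ p.length = condC U x z := by
  obtain ⟨c, hc⟩ := hU.condC_le_length
  obtain ⟨p, hp⟩ := (hc x z).1
  exact Nat.sInf_mem (s := {k : ℕ | ∃ p : Str, x ∈ U p z ∧ p.length = k}) ⟨_, p, hp, rfl⟩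

theorem IsOptimal.condC_le_iff (hU : IsOptimal U) {x z : Str} {k : ℕ} :
    condC U x z ≤ k ↔ ∃ p, x ∈ U p z ∧ p.length ≤ k := by
  constructor
  · intro h
    obtain ⟨p, hp, hl⟩ := hU.exists_description x z
    exact ⟨p, hp, hl.trans_le h⟩
  · rintro ⟨p, hp, hl⟩
    exact (condC_le_of_mem hp).trans hl

/-- An upper bound on complexity is confirmed once a short program halts. This is why every
enumerated set below is cut out by upper bounds only. -/
theorem IsOptimal.semidecidable_condC_le (hU : IsOptimal U) :
    Semidecidable fun q : (Str × Str) × ℕ => condC U q.1.1 q.1.2 ≤ q.2 := by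
  have h1 : Semidecidable fun q : ((Str × Str) × ℕ) × Str => q.1.1.1 ∈ U q.2 q.1.1.2 := by
    have := Semidecidable.of_partrec hU.1
    exact this.comp (f := fun q : ((Str × Str) × ℕ) × Str => ((q.2, q.1.1.2), q.1.1.1))
      ((Primrec.snd.pair (Primrec.snd.comp (Primrec.fst.comp Primrec.fst))).pair
        (Primrec.fst.comp (Primrec.fst.comp Primrec.fst)))
  have h2 : PrimrecPred fun q : ((Str × Str) × ℕ) × Str => q.2.length ≤ q.1.2 :=
    PrimrecRel.comp Primrec.nat_le (Primrec.list_length.comp Primrec.snd)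
      (Primrec.snd.comp Primrec.fst)
  exact (h1.and (Semidecidable.of_primrecPred h2)).ex.of_iff fun q => hU.condC_le_iff

theorem exists_finset_length_le (k : ℕ) :
    ∃ S : Finset Str, (∀ p : Str, p.length ≤ k → p ∈ S) ∧ S.card ≤ 2 ^ (k + 1) := by
  refine ⟨(Finset.range (k + 1)).biUnion fun i =>
    (Finset.univ : Finset (List.Vector Bool i)).image List.Vector.toList, fun p hp => ?_, ?_⟩
  · simp only [Finset.mem_biUnion, Finset.mem_range, Finset.mem_image, Finset.mem_univ, true_and]
    exact ⟨p.length, by omega, ⟨p, rfl⟩, rfl⟩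
  · refine Finset.card_biUnion_le.trans ?_
    calc _ ≤ ∑ i ∈ Finset.range (k + 1), 2 ^ i := by
          refine Finset.sum_le_sum fun i _ => Finset.card_image_le.trans ?_
          simp
      _ ≤ 2 ^ (k + 1) := (Nat.geomSum_lt le_rfl (by simp)).le

/-- Each program has at most one output on the condition `z`, so it is enough to count programs. -/
theorem IsOptimal.exists_finset_condC_le (hU : IsOptimal U) (z : Str) (k : ℕ) :
    ∃ S : Finset Str, (∀ x, condC U x z ≤ k → x ∈ S) ∧ S.card ≤ 2 ^ (k + 1) := by
  obtain ⟨T, hT, hcard⟩ := exists_finset_length_le k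
  classical
  refine ⟨T.biUnion fun p => if h : (U p z).Dom then {(U p z).get h} else ∅, fun x hx => ?_, ?_⟩
  · obtain ⟨p, ⟨hd, rfl⟩, hp⟩ := hU.condC_le_iff.1 hx
    exact Finset.mem_biUnion.2 ⟨p, hT p hp, by simp [hd]⟩
  · refine Finset.card_biUnion_le.trans ((Finset.sum_le_card_nsmul _ _ 1 fun p _ => ?_).trans ?_)
    · split_ifs <;> simp
    · simpa using hcard

theorem IsOptimal.card_le_of_forall_condC_le (hU : IsOptimal U) {z : Str} {k : ℕ} {F : Finset Str}
    (hF : ∀ x ∈ F, condC U x z ≤ k) : F.card ≤ 2 ^ (k + 1) := by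
  obtain ⟨S, hS, hcard⟩ := hU.exists_finset_condC_le z k
  exact (Finset.card_le_card fun x hx => hS x (hF x hx)).trans hcard

/-! ### Complexity bounds by enumeration; symmetry of information -/

/-- An element of a semidecidable set of size at most `2 ^ k` can be described by its number in an
enumeration of the set. -/
theorem IsOptimal.condC_le_of_card_le (hU : IsOptimal U) {γ : Type*} [Primcodable γ]
    {P : (γ × Str) × Str → Prop} (h : Semidecidable P) :
    ∃ c, ∀ e z x k, P ((e, z), x) →
      (∀ F : Finset Str, (∀ x ∈ F, P ((e, z), x)) → F.card ≤ 2 ^ k) →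
      condC U x z ≤ k + 2 * (Encodable.encode e).size + c := by
  obtain ⟨Q, hQ, huniq, hnum⟩ := h.exists_numbering
  -- A program is a `pair` of the bits of the parameter's code and the bits of the index. Since
  -- `pair` doubles its first component, the parameter costs twice its size; the separator costs 2
  -- more bits.
  let T : (Str × Str) × Str → Prop := fun q => ∃ s : (γ × Str) × Str,
    (q.1.1 = pair s.1.2 s.2 ∧ natOfBits s.1.2 = Encodable.encode s.1.1) ∧
      Q (((s.1.1, q.1.2), natOfBits s.2), q.2)
  have hT : Semidecidable T := by
    have e1 : Primrec fun p : ((Str × Str) × Str) × ((γ × Str) × Str) => p.2.1.1 :=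
      Primrec.fst.comp (Primrec.fst.comp Primrec.snd)
    have e2 : Primrec fun p : ((Str × Str) × Str) × ((γ × Str) × Str) => p.2.1.2 :=
      Primrec.snd.comp (Primrec.fst.comp Primrec.snd)
    have e3 : Primrec fun p : ((Str × Str) × Str) × ((γ × Str) × Str) => p.2.2 :=
      Primrec.snd.comp Primrec.snd
    have e4 : Primrec fun p : ((Str × Str) × Str) × ((γ × Str) × Str) => p.1.1.1 :=
      Primrec.fst.comp (Primrec.fst.comp Primrec.fst)
    have e5 : Primrec fun p : ((Str × Str) × Str) × ((γ × Str) × Str) => p.1.1.2 :=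
      Primrec.snd.comp (Primrec.fst.comp Primrec.fst)
    have e6 : Primrec fun p : ((Str × Str) × Str) × ((γ × Str) × Str) => p.1.2 :=
      Primrec.snd.comp Primrec.fst
    exact Semidecidable.ex (Semidecidable.and (Semidecidable.of_primrecPred (PrimrecPred.and
      (PrimrecRel.comp Primrec.eq e4 (primrec_pair.comp e2 e3))
      (PrimrecRel.comp Primrec.eq (primrec_natOfBits.comp e2) (Primrec.encode.comp e1))))
      (hQ.comp (((e1.pair e5).pair (primrec_natOfBits.comp e3)).pair e6)))
  have hTu : ∀ a b b', T (a, b) → T (a, b') → b = b' := by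
    rintro ⟨p, z⟩ b b' ⟨⟨⟨e, s⟩, i⟩, ⟨h1, h2⟩, h3⟩ ⟨⟨⟨e', s'⟩, i'⟩, ⟨h1', h2'⟩, h3'⟩
    simp only at h1 h2 h3 h1' h2' h3'
    obtain ⟨rfl, rfl⟩ := pair_inj.1 (h1.symm.trans h1')
    obtain rfl := Encodable.encode_injective (h2.symm.trans h2')
    exact huniq _ _ _ _ h3 h3'
  obtain ⟨V, hV, hVT⟩ := hT.exists_partrec hTu
  obtain ⟨c, hc⟩ := hU.2 (fun p z => V (p, z)) hV
  refine ⟨c + 2, fun e z x k hx hcard => ?_⟩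
  obtain ⟨i, hi, hQi⟩ := hnum (e, z) x (2 ^ k) hx hcard
  have hmem : x ∈ V (pair (Encodable.encode e).bits i.bits, z) := by
    refine hVT _ _ ⟨((e, (Encodable.encode e).bits), i.bits), ⟨rfl, natOfBits_bits _⟩, ?_⟩
    rw [natOfBits_bits]
    exact hQi
  obtain ⟨p, hp, hl⟩ := hc _ _ _ hmem
  have := condC_le_of_mem hp
  rw [length_pair, Nat.size_eq_bits_len, Nat.size_eq_bits_len] at hl
  have := Nat.size_le.2 hi
  omega

/-- A pair is described by a description of one of its elements and a conditional description of
the other. -/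
theorem IsOptimal.plainC_le_add (hU : IsOptimal U) {f : Str → Str → Str} (hf : Primrec₂ f) :
    ∃ c, ∀ M u v, plainC U u ≤ M → condC U v u ≤ M →
      plainC U (f u v) ≤ plainC U u + condC U v u + c * (M.size + 1) := by
  -- The parameters are the two complexity values. Being at most `M`, they cost only O(log M) bits.
  let P : ((ℕ × ℕ) × Str) × Str → Prop := fun q => ∃ s : Str × Str,
    q.2 = f s.1 s.2 ∧ plainC U s.1 ≤ q.1.1.1 ∧ condC U s.2 s.1 ≤ q.1.1.2
  have hP : Semidecidable P := by
    have e1 : Primrec fun p : (((ℕ × ℕ) × Str) × Str) × (Str × Str) => p.2.1 :=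
      Primrec.fst.comp Primrec.snd
    have e2 : Primrec fun p : (((ℕ × ℕ) × Str) × Str) × (Str × Str) => p.2.2 :=
      Primrec.snd.comp Primrec.snd
    have e3 : Primrec fun p : (((ℕ × ℕ) × Str) × Str) × (Str × Str) => p.1.1.1.1 :=
      Primrec.fst.comp (Primrec.fst.comp (Primrec.fst.comp Primrec.fst))
    have e4 : Primrec fun p : (((ℕ × ℕ) × Str) × Str) × (Str × Str) => p.1.1.1.2 :=
      Primrec.snd.comp (Primrec.fst.comp (Primrec.fst.comp Primrec.fst))
    exact Semidecidable.ex (Semidecidable.and (Semidecidable.of_primrecPred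
      (PrimrecRel.comp Primrec.eq (Primrec.snd.comp Primrec.fst) (hf.comp e1 e2)))
      (Semidecidable.and
        (hU.semidecidable_condC_le.comp ((e1.pair (Primrec.const [])).pair e3))
        (hU.semidecidable_condC_le.comp ((e2.pair e1).pair e4))))
  obtain ⟨c, hc⟩ := hU.condC_le_of_card_le hP
  refine ⟨c + 4, fun M u v hu hv => ?_⟩
  have := hc (plainC U u, condC U v u) [] (f u v) (plainC U u + 1 + (condC U v u + 1))
    ⟨(u, v), rfl, le_rfl, le_rfl⟩ ?_
  · have hs : (Encodable.encode (plainC U u, condC U v u)).size ≤ 2 * M.size := by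
      simp only [Encodable.encode_prod_val, Encodable.encode_nat]
      exact size_pair_le (Nat.size_le_size hu) (Nat.size_le_size hv)
    unfold plainC at *
    nlinarith
  · intro F hF
    obtain ⟨S, hS, hScard⟩ := hU.exists_finset_condC_le [] (plainC U u)
    choose S' hS' hScard' using fun u' => hU.exists_finset_condC_le u' (condC U v u)
    have hsub : F ⊆ S.biUnion fun u' => (S' u').image (f u') := by
      intro x hx
      obtain ⟨⟨u', v'⟩, h1, h2, h3⟩ := hF x hx
      exact Finset.mem_biUnion.2 ⟨u', hS _ h2, Finset.mem_image.2 ⟨v', hS' _ _ h3, h1.symm⟩⟩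
    refine (Finset.card_le_card hsub).trans ((Finset.card_biUnion_le_card_mul _ _ _
      fun u' _ => Finset.card_image_le.trans (hScard' u')).trans ?_)
    rw [pow_add _ (plainC U u + 1)]
    exact Nat.mul_le_mul_right _ hScard

/-- An additional condition does not increase the complexity. -/
theorem IsOptimal.condC_pair_le (hU : IsOptimal U) :
    ∃ c, ∀ M x u v, condC U x v ≤ M → condC U x (pair u v) ≤ condC U x v + c * (M.size + 1) := by
  let P : (ℕ × Str) × Str → Prop := fun q => ∃ s : Str × Str,
    q.1.2 = pair s.1 s.2 ∧ condC U q.2 s.2 ≤ q.1.1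
  have hP : Semidecidable P := by
    have e1 : Primrec fun p : ((ℕ × Str) × Str) × (Str × Str) => p.2.1 :=
      Primrec.fst.comp Primrec.snd
    have e2 : Primrec fun p : ((ℕ × Str) × Str) × (Str × Str) => p.2.2 :=
      Primrec.snd.comp Primrec.snd
    exact Semidecidable.ex (Semidecidable.and (Semidecidable.of_primrecPred
      (PrimrecRel.comp Primrec.eq (Primrec.snd.comp (Primrec.fst.comp Primrec.fst))
        (primrec_pair.comp e1 e2)))
      (hU.semidecidable_condC_le.comp
        (((Primrec.snd.comp Primrec.fst).pair e2).pair
          (Primrec.fst.comp (Primrec.fst.comp Primrec.fst)))))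
  obtain ⟨c, hc⟩ := hU.condC_le_of_card_le hP
  refine ⟨c + 3, fun M x u v hx => ?_⟩
  have := hc (condC U x v) (pair u v) x (condC U x v + 1) ⟨(u, v), rfl, le_rfl⟩ ?_
  · have hs : (Encodable.encode (condC U x v)).size ≤ M.size := Nat.size_le_size hx
    nlinarith
  · intro F hF
    refine hU.card_le_of_forall_condC_le (z := v) fun x' hx' => ?_
    obtain ⟨⟨u', v'⟩, h1, h2⟩ := hF x' hx'
    obtain ⟨rfl, rfl⟩ := pair_inj.1 h1
    exact h2

/-- For a semidecidable relation `B` between `u` and `v`, if the number of `v` related to `u` is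
about `2 ^ j`, then `v` has complexity at most about `j` given `u`, and `u` can be described by its
number among the strings that have at least `2 ^ j` related strings. -/
theorem IsOptimal.exists_slice_size (hU : IsOptimal U) {γ : Type*} [Primcodable γ]
    {B : (γ × Str) × (Str × Str) → Prop} (hB : Semidecidable B) :
    ∃ c, ∀ e w u v, B ((e, w), (u, v)) → {v' | B ((e, w), (u, v'))}.Finite →
      ∃ j, condC U v (pair u w) ≤ j + 2 * (Encodable.encode e).size + c ∧
        condC U v (pair w u) ≤ j + 2 * (Encodable.encode e).size + c ∧
        (∃ F : Finset Str, 2 ^ j ≤ F.card ∧ ∀ v' ∈ F, B ((e, w), (u, v'))) ∧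
        ∀ k, (∀ F : Finset Str, (∀ u' ∈ F, ∃ F' : Finset Str, 2 ^ j ≤ F'.card ∧
            ∀ v' ∈ F', B ((e, w), (u', v'))) → F.card ≤ 2 ^ k) →
          condC U u w ≤ k + 2 * (Encodable.encode (e, j)).size + c := by
  have p1 : Primrec fun p : ((γ × Str) × Str) × (Str × Str) => p.1.1.1 :=
    Primrec.fst.comp (Primrec.fst.comp Primrec.fst)
  have p2 : Primrec fun p : ((γ × Str) × Str) × (Str × Str) => p.1.1.2 :=
    Primrec.snd.comp (Primrec.fst.comp Primrec.fst)
  have p3 : Primrec fun p : ((γ × Str) × Str) × (Str × Str) => p.1.2 :=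
    Primrec.snd.comp Primrec.fst
  have p4 : Primrec fun p : ((γ × Str) × Str) × (Str × Str) => p.2.1 :=
    Primrec.fst.comp Primrec.snd
  have p5 : Primrec fun p : ((γ × Str) × Str) × (Str × Str) => p.2.2 :=
    Primrec.snd.comp Primrec.snd
  have h1 : Semidecidable fun q : (γ × Str) × Str => ∃ s : Str × Str,
      q.1.2 = pair s.1 s.2 ∧ B ((q.1.1, s.2), (s.1, q.2)) :=
    Semidecidable.ex (Semidecidable.and (Semidecidable.of_primrecPred
      (PrimrecRel.comp Primrec.eq p2 (primrec_pair.comp p4 p5)))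
      (hB.comp ((p1.pair p5).pair (p4.pair p3))))
  have h2 : Semidecidable fun q : (γ × Str) × Str => ∃ s : Str × Str,
      q.1.2 = pair s.1 s.2 ∧ B ((q.1.1, s.1), (s.2, q.2)) :=
    Semidecidable.ex (Semidecidable.and (Semidecidable.of_primrecPred
      (PrimrecRel.comp Primrec.eq p2 (primrec_pair.comp p4 p5)))
      (hB.comp ((p1.pair p4).pair (p5.pair p3))))
  have h3 : Semidecidable fun q : ((γ × ℕ) × Str) × Str => ∃ F' : Finset Str,
      2 ^ q.1.1.2 ≤ F'.card ∧ ∀ v' ∈ F', B ((q.1.1.1, q.1.2), (q.2, v')) := by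
    have hpow : Primrec fun n : ℕ => 2 ^ n := by
      refine (Primrec.nat_rec₁ 1 (f := fun _ IH => 2 * IH)
        (Primrec.nat_mul.comp (Primrec.const 2) Primrec.snd)).of_eq fun n => ?_
      induction n with
      | zero => rfl
      | succ n ih => rw [pow_succ, mul_comm, ← ih]
    have hB' : Semidecidable fun p : (((γ × ℕ) × Str) × Str) × Str =>
        B ((p.1.1.1.1, p.1.1.2), (p.1.2, p.2)) :=
      hB.comp (((Primrec.fst.comp (Primrec.fst.comp (Primrec.fst.comp Primrec.fst))).pair
        (Primrec.snd.comp (Primrec.fst.comp Primrec.fst))).pair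
        ((Primrec.snd.comp Primrec.fst).pair Primrec.snd))
    exact hB'.exists_card_le
      (hpow.comp (Primrec.snd.comp (Primrec.fst.comp Primrec.fst)))
  obtain ⟨c1, hc1⟩ := hU.condC_le_of_card_le h1
  obtain ⟨c2, hc2⟩ := hU.condC_le_of_card_le h2
  obtain ⟨c3, hc3⟩ := hU.condC_le_of_card_le h3
  refine ⟨c1 + c2 + c3 + 1, fun e w u v huv hfin => ?_⟩
  set S := hfin.toFinset
  have hS : ∀ v', v' ∈ S ↔ B ((e, w), (u, v')) := fun v' => by simp [S]
  have hS0 : S.card ≠ 0 := Finset.card_ne_zero_of_mem ((hS v).2 huv)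
  have hlow : 2 ^ Nat.log 2 S.card ≤ S.card := Nat.pow_log_le_self 2 hS0
  have hup : S.card ≤ 2 ^ (Nat.log 2 S.card + 1) := (Nat.lt_pow_succ_log_self one_lt_two _).le
  -- The floor of the logarithm makes 2^j a lower bound for the slice size and 2^(j+1) an upper
  -- bound; the lost bit goes into the constant.
  refine ⟨Nat.log 2 S.card, ?_, ?_, ⟨S, hlow, fun v' hv' => (hS v').1 hv'⟩, fun k hk => ?_⟩
  · have := hc1 e (pair u w) v (Nat.log 2 S.card + 1) ⟨(u, w), rfl, huv⟩ fun F hF => by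
      refine (Finset.card_le_card fun v' hv' => (hS v').2 ?_).trans hup
      obtain ⟨⟨u', w'⟩, h1, h2⟩ := hF v' hv'
      obtain ⟨rfl, rfl⟩ := pair_inj.1 h1
      exact h2
    omega
  · have := hc2 e (pair w u) v (Nat.log 2 S.card + 1) ⟨(w, u), rfl, huv⟩ fun F hF => by
      refine (Finset.card_le_card fun v' hv' => (hS v').2 ?_).trans hup
      obtain ⟨⟨u', w'⟩, h1, h2⟩ := hF v' hv'
      obtain ⟨rfl, rfl⟩ := pair_inj.1 h1
      exact h2
    omega
  · have := hc3 (e, Nat.log 2 S.card) w u k ⟨S, hlow, fun v' hv' => (hS v').1 hv'⟩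
      fun F hF => hk F hF
    omega

/-- Symmetry of information. -/
theorem IsOptimal.condC_add_condC_le (hU : IsOptimal U) :
    ∃ c, ∀ M u v w, condC U v w ≤ M → condC U u (pair v w) ≤ M →
      condC U u w + condC U v (pair w u) ≤
        condC U v w + condC U u (pair v w) + c * (M.size + 1) := by
  -- For fixed parameters (a, b) there are at most 2^(a+1) choices of v, each with at most 2^(b+1)
  -- choices of u. Hence at most 2^(a+b+2-j) strings u have 2^j partners v.
  let B : ((ℕ × ℕ) × Str) × (Str × Str) → Prop := fun q =>
    condC U q.2.2 q.1.2 ≤ q.1.1.1 ∧ condC U q.2.1 (pair q.2.2 q.1.2) ≤ q.1.1.2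
  have hB : Semidecidable B := by
    have p1 : Primrec fun q : ((ℕ × ℕ) × Str) × (Str × Str) => q.2.2 :=
      Primrec.snd.comp Primrec.snd
    have p2 : Primrec fun q : ((ℕ × ℕ) × Str) × (Str × Str) => q.1.2 :=
      Primrec.snd.comp Primrec.fst
    exact Semidecidable.and
      (hU.semidecidable_condC_le.comp ((p1.pair p2).pair
        (Primrec.fst.comp (Primrec.fst.comp Primrec.fst))))
      (hU.semidecidable_condC_le.comp (((Primrec.fst.comp Primrec.snd).pair
        (primrec_pair.comp p1 p2)).pair (Primrec.snd.comp (Primrec.fst.comp Primrec.fst))))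
  obtain ⟨c, hc⟩ := hU.exists_slice_size hB
  refine ⟨2 * c + 20, fun M u v w hv hu => ?_⟩
  set a := condC U v w with ha
  set b := condC U u (pair v w) with hb
  obtain ⟨S, hS, hScard⟩ := hU.exists_finset_condC_le w a
  obtain ⟨j, -, hj1, ⟨F, hF, hFB⟩, hj2⟩ := hc (a, b) w u v ⟨le_rfl, le_rfl⟩
    (S.finite_toSet.subset fun v' hv' => hS v' hv'.1)
  have hja : j ≤ a + 1 := by
    refine (Nat.pow_le_pow_iff_right one_lt_two).1 (hF.trans ((Finset.card_le_card ?_).trans hScard))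
    exact fun v' hv' => hS v' (hFB v' hv').1
  have hjM : j.size ≤ M.size + 1 :=
    (Nat.size_le_size (hja.trans (Nat.succ_le_succ hv))).trans (size_succ_le M)
  have hs1 : (Encodable.encode (a, b)).size ≤ 2 * M.size := by
    simp only [Encodable.encode_prod_val, Encodable.encode_nat]
    exact size_pair_le (Nat.size_le_size hv) (Nat.size_le_size hu)
  have hs2 : (Encodable.encode ((a, b), j)).size ≤ 2 * (2 * (M.size + 1)) := by
    rw [Encodable.encode_prod_val]
    refine size_pair_le (hs1.trans (by omega)) ?_
    simp only [Encodable.encode_nat]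
    omega
  -- The subtraction is not truncated, because j ≤ a + 1.
  have := hj2 (a + 1 + (b + 1) - j) fun F hF => by
    have hmul : F.card * 2 ^ j ≤ S.card * 2 ^ (b + 1) := by
      classical
      refine Finset.card_mul_le_card_mul
        (fun (u' v' : Str) => B (((a, b), w), (u', v'))) (fun u' hu' => ?_) fun v' _ => ?_
      · obtain ⟨F', hF', hB'⟩ := hF u' hu'
        refine hF'.trans (Finset.card_le_card fun v' hv' => ?_)
        exact (Finset.mem_bipartiteAbove _).2 ⟨hS v' (hB' v' hv').1, hB' v' hv'⟩
      · refine hU.card_le_of_forall_condC_le (z := pair v' w) fun u' hu' => ?_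
        exact ((Finset.mem_bipartiteBelow _).1 hu').2.2
    refine Nat.le_of_mul_le_mul_right (hmul.trans ?_) (Nat.two_pow_pos j)
    rw [← pow_add, Nat.sub_add_cancel (by omega), pow_add 2 (a + 1)]
    exact Nat.mul_le_mul_right _ hScard
  have : a + 1 + (b + 1) - j + j = a + b + 2 := by omega
  nlinarith

end

end Kolmogorov

/-! ### Counting vertices with many neighbours in a given set -/

/-- Suppose that every element of `S` is similar (in the sense of `s`) to at most `2 ^ m` elements
of `S`, and that dissimilar elements of `S` have at most `K` common neighbours in `F`. If every
element of `F` has at least `2 ^ j` neighbours in `S`, where `j > m`, then `F` is small. -/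
theorem card_mul_two_pow_le {α β : Type*} {F : Finset α} {S : Finset β} {r : α → β → Prop}
    {s : β → β → Prop} [DecidableRel r] [DecidableRel s] {m j K : ℕ} (hmj : m < j)
    (hs : ∀ y ∈ S, (S.filter (s y)).card ≤ 2 ^ m)
    (hK : ∀ y ∈ S, ∀ y' ∈ S, ¬ s y y' → (F.filter fun x => r x y ∧ r x y').card ≤ K)
    (hF : ∀ x ∈ F, 2 ^ j ≤ (S.filter (r x)).card) :
    F.card * (2 ^ j * 2 ^ (j - 1)) ≤ S.card * S.card * K := by
  classical
  rw [← Finset.card_product]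
  refine Finset.card_mul_le_card_mul
    (fun (x : α) (p : β × β) => (r x p.1 ∧ r x p.2) ∧ ¬ s p.1 p.2) (fun x hx => ?_)
    fun p hp => ?_
  · have hsig : ((S.filter (r x)).sigma fun y => (S.filter (r x)).filter fun y' => ¬ s y y').card
        ≤ ((S ×ˢ S).bipartiteAbove
          (fun (x : α) (p : β × β) => (r x p.1 ∧ r x p.2) ∧ ¬ s p.1 p.2) x).card := by
      refine Finset.card_le_card_of_injOn (fun p => (p.1, p.2)) (fun p hp => ?_) ?_
      · simp only [Finset.mem_coe, Finset.mem_sigma, Finset.mem_filter] at hp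
        simp only [Finset.mem_coe, Finset.mem_bipartiteAbove, Finset.mem_product]
        tauto
      · rintro ⟨y, y'⟩ - ⟨z, z'⟩ - h
        simpa using h
    refine le_trans ?_ hsig
    rw [Finset.card_sigma]
    refine le_trans (Nat.mul_le_mul_right _ (hF x hx)) ?_
    rw [← smul_eq_mul]
    refine Finset.card_nsmul_le_sum _ _ _ fun y hy => ?_
    -- At most 2^m ≤ 2^(j-1) of the at least 2^j neighbours are similar to `y`, so at least 2^(j-1)
    -- dissimilar ones remain.
    have hsplit := Finset.card_filter_add_card_filter_not (s := S.filter (r x)) (s y)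
    have h1 : ((S.filter (r x)).filter (s y)).card ≤ 2 ^ m :=
      (Finset.card_le_card (Finset.filter_subset_filter _ (Finset.filter_subset _ _))).trans
        (hs y (Finset.mem_filter.1 hy).1)
    have h2 : 2 ^ m ≤ 2 ^ (j - 1) := Nat.pow_le_pow_right two_pos (by omega)
    have h3 : 2 ^ j = 2 ^ (j - 1) + 2 ^ (j - 1) := by
      rw [← two_mul, ← pow_succ', Nat.sub_add_cancel (by omega)]
    have h4 := hF x hx
    omega
  · obtain ⟨hy, hy'⟩ := Finset.mem_product.1 hp
    by_cases h : s p.1 p.2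
    · simp [Finset.bipartiteBelow, h]
    · refine le_trans (Finset.card_le_card fun x hx => ?_) (hK p.1 hy p.2 hy' h)
      simp only [Finset.bipartiteBelow, Finset.mem_filter] at hx ⊢
      exact ⟨hx.1, hx.2.1⟩

namespace Kolmogorov

/-- Adjacency of the codes of the vertices of an amplified graph. -/
def CodeAdj (E : Str → Str → Prop) (m : ℕ) (X Y : Str) : Prop :=
  ∃ s : (Str × Str) × (Str × Str), E s.1.1 s.2.1 ∧
    (X = pair s.1.1 s.1.2 ∧ Y = pair s.2.1 s.2.2) ∧ s.1.2.length = m ∧ s.2.2.length = m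

/-- Take codes to be similar when their graph components agree: the random component leaves 2^m
choices. For distinct graph components there are at most d common neighbours in `G`, each with 2^m
codes. -/
theorem card_mul_two_pow_le_of_codeAdj {G : BipartiteGraph Str Str} {d : ℕ}
    (hG : G.BoundedCommonNeighborhoodRight d) {m j : ℕ} (hmj : m < j) {F S : Finset Str}
    (hF : ∀ X ∈ F, ∃ F' : Finset Str, 2 ^ j ≤ F'.card ∧
      ∀ Y ∈ F', Y ∈ S ∧ CodeAdj (fun x y => (x, y) ∈ G.edges) m X Y) :
    F.card * (2 ^ j * 2 ^ (j - 1)) ≤ S.card * S.card * (d * 2 ^ m) := by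
  classical
  refine card_mul_two_pow_le (r := CodeAdj (fun x y => (x, y) ∈ G.edges) m)
    (s := fun Y Y' => ∃ y r r', Y = pair y r ∧ Y' = pair y r' ∧ r'.length = m) hmj
    (fun Y _ => ?_) (fun Y _ Y' _ hne => ?_) fun X hX => ?_
  · rcases Finset.eq_empty_or_nonempty (S.filter fun Y' =>
        ∃ y r r', Y = pair y r ∧ Y' = pair y r' ∧ r'.length = m) with h | ⟨Y', hY'⟩
    · rw [h]
      exact Nat.zero_le _
    · obtain ⟨-, y, r, -, rfl, -, -⟩ := Finset.mem_filter.1 hY'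
      have hsub : (S.filter fun Y' =>
          ∃ y' r' r'', pair y r = pair y' r' ∧ Y' = pair y' r'' ∧ r''.length = m) ⊆
          ((Finset.univ : Finset (List.Vector Bool m)).image List.Vector.toList).image
            (pair y) := by
        intro Z hZ
        obtain ⟨-, y', r', r'', h1, rfl, h3⟩ := Finset.mem_filter.1 hZ
        obtain ⟨rfl, rfl⟩ := pair_inj.1 h1
        exact Finset.mem_image_of_mem _
          (Finset.mem_image.2 ⟨⟨r'', h3⟩, Finset.mem_univ _, rfl⟩)
      refine (Finset.card_le_card hsub).trans (Finset.card_image_le.trans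
        (Finset.card_image_le.trans ?_))
      simp
  · rcases Finset.eq_empty_or_nonempty (F.filter fun X =>
        CodeAdj (fun x y => (x, y) ∈ G.edges) m X Y ∧
        CodeAdj (fun x y => (x, y) ∈ G.edges) m X Y') with h | ⟨X, hX⟩
    · simp [h]
    · obtain ⟨-, ⟨⟨⟨x, t⟩, y, r⟩, h1, ⟨h2, rfl⟩, h3, h4⟩,
        ⟨⟨x', t'⟩, y', r'⟩, h1', ⟨h2', rfl⟩, h3', h4'⟩ := Finset.mem_filter.1 hX
      simp only at h1 h2 h3 h4 h1' h2' h3' h4' hne ⊢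
      have hyy : y ≠ y' := by
        rintro rfl
        exact hne ⟨y, r, r', rfl, rfl, h4'⟩
      have hcommon := hG y (Finset.mem_product.1 (G.edges_subset h1)).2 y'
        (Finset.mem_product.1 (G.edges_subset h1')).2 hyy
      set C := G.left.filter fun x => (x, y) ∈ G.edges ∧ (x, y') ∈ G.edges
      have hsub : (F.filter fun X => CodeAdj (fun x y => (x, y) ∈ G.edges) m X (pair y r) ∧
          CodeAdj (fun x y => (x, y) ∈ G.edges) m X (pair y' r')) ⊆
          (C ×ˢ (Finset.univ : Finset (List.Vector Bool m))).image fun p => pair p.1 p.2.toList := by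
        intro Z hZ
        obtain ⟨-, ⟨⟨⟨z, t⟩, y₁, r₁⟩, g1, ⟨g2, g3⟩, g4, -⟩,
          ⟨⟨z', t'⟩, y₁', r₁'⟩, g1', ⟨g2', g3'⟩, -, -⟩ := Finset.mem_filter.1 hZ
        simp only at g1 g2 g3 g4 g1' g2' g3'
        obtain ⟨rfl, rfl⟩ := pair_inj.1 g3
        obtain ⟨rfl, rfl⟩ := pair_inj.1 g3'
        obtain ⟨rfl, rfl⟩ := pair_inj.1 (g2.symm.trans g2')
        refine Finset.mem_image.2 ⟨(z, ⟨t, g4⟩), Finset.mem_product.2 ⟨?_, Finset.mem_univ _⟩,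
          g2.symm⟩
        exact Finset.mem_filter.2 ⟨(Finset.mem_product.1 (G.edges_subset g1)).1, g1, g1'⟩
      refine (Finset.card_le_card hsub).trans (Finset.card_image_le.trans ?_)
      rw [Finset.card_product]
      refine (Nat.mul_le_mul_right _ hcommon).trans ?_
      simp
  · obtain ⟨F', hF', h⟩ := hF X hX
    exact hF'.trans (Finset.card_le_card fun Y hY => Finset.mem_filter.2 (h Y hY))

/-! ### Complexity of neighbours in an explicitly given graph -/

variable {U : Str → Str →. Str} {A : ℕ → ℕ →. List Str × List Str × List (Str × Str)}

/-- Formulated through the output of `A` rather than a fixed graph, so that one enumeration serves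
all parameters and the constants do not depend on `G`. -/
theorem semidecidable_mem_edges (hA : Partrec₂ A) :
    Semidecidable fun q : (ℕ × ℕ) × (Str × Str) => ∃ l, l ∈ A q.1.1 q.1.2 ∧ q.2 ∈ l.2.2 := by
  have h1 : Semidecidable fun p : ((ℕ × ℕ) × (Str × Str)) ×
      (List Str × List Str × List (Str × Str)) => p.2 ∈ A p.1.1.1 p.1.1.2 := by
    have := Semidecidable.of_partrec hA
    exact this.comp (f := fun p : ((ℕ × ℕ) × (Str × Str)) ×
      (List Str × List Str × List (Str × Str)) => (p.1.1, p.2))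
      ((Primrec.fst.comp Primrec.fst).pair Primrec.snd)
  have h2 : PrimrecPred fun p : ((ℕ × ℕ) × (Str × Str)) ×
      (List Str × List Str × List (Str × Str)) => ∃ e ∈ p.2.2.2, e = p.1.2 :=
    PrimrecRel.comp (PrimrecRel.exists_mem_list Primrec.eq)
      (Primrec.snd.comp (Primrec.snd.comp Primrec.snd)) (Primrec.snd.comp Primrec.fst)
  exact (h1.and (Semidecidable.of_primrecPred h2)).ex.of_iff fun q => by simp

theorem exists_mem_edges_iff {G : BipartiteGraph Str Str} {k d : ℕ}
    (hl : ∃ l ∈ A k d, G.IsListedBy l) (e : Str × Str) :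
    (∃ l, l ∈ A k d ∧ e ∈ l.2.2) ↔ e ∈ G.edges := by
  obtain ⟨l, hl, -, -, hE⟩ := hl
  rw [← hE, List.mem_toFinset]
  constructor
  · rintro ⟨l', hl', he⟩
    rwa [Part.mem_unique hl hl']
  · exact fun he => ⟨l, hl, he⟩

/-- A neighbour is given by its number in the enumeration of the neighbourhood, whose size is q^d or
q; the parameters handed to `A` cost O(log M) bits. -/
theorem IsOptimal.condC_neighbor_le (hU : IsOptimal U) (hA : Partrec₂ A) :
    ∃ c, ∀ (q d M : ℕ) (G : BipartiteGraph Str Str), G.HasProfile q d →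
      (∃ l ∈ A (Nat.log 2 q) d, G.IsListedBy l) → Nat.log 2 q ≤ M → d ≤ M →
      ∀ x y, (x, y) ∈ G.edges →
        condC U y x ≤ Nat.clog 2 (q ^ d) + c * (M.size + 1) ∧
        condC U x y ≤ Nat.clog 2 q + c * (M.size + 1) := by
  have hE := semidecidable_mem_edges hA
  have h1 : Semidecidable fun p : ((ℕ × ℕ) × Str) × Str =>
      ∃ l, l ∈ A p.1.1.1 p.1.1.2 ∧ (p.1.2, p.2) ∈ l.2.2 :=
    hE.comp (f := fun p : ((ℕ × ℕ) × Str) × Str => (p.1.1, (p.1.2, p.2)))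
      ((Primrec.fst.comp Primrec.fst).pair ((Primrec.snd.comp Primrec.fst).pair Primrec.snd))
  have h2 : Semidecidable fun p : ((ℕ × ℕ) × Str) × Str =>
      ∃ l, l ∈ A p.1.1.1 p.1.1.2 ∧ (p.2, p.1.2) ∈ l.2.2 :=
    hE.comp (f := fun p : ((ℕ × ℕ) × Str) × Str => (p.1.1, (p.2, p.1.2)))
      ((Primrec.fst.comp Primrec.fst).pair (Primrec.snd.pair (Primrec.snd.comp Primrec.fst)))
  obtain ⟨c1, hc1⟩ := hU.condC_le_of_card_le h1
  obtain ⟨c2, hc2⟩ := hU.condC_le_of_card_le h2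
  refine ⟨c1 + c2 + 4, fun q d M G hG hl hq hd x y hxy => ?_⟩
  have hs : (Encodable.encode (Nat.log 2 q, d)).size ≤ 2 * M.size := by
    simp only [Encodable.encode_prod_val, Encodable.encode_nat]
    exact size_pair_le (Nat.size_le_size hq) (Nat.size_le_size hd)
  have hxy' := Finset.mem_product.1 (G.edges_subset hxy)
  have k1 := hc1 (Nat.log 2 q, d) x y (Nat.clog 2 (q ^ d)) ((exists_mem_edges_iff hl _).2 hxy)
    fun F hF => by
      refine le_trans ?_ (Nat.le_pow_clog one_lt_two _)
      rw [← hG.2.2.2 x hxy'.1]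
      refine Finset.card_le_card fun y' hy' => ?_
      have := (exists_mem_edges_iff hl _).1 (hF y' hy')
      exact Finset.mem_filter.2 ⟨(Finset.mem_product.1 (G.edges_subset this)).2, this⟩
  have k2 := hc2 (Nat.log 2 q, d) y x (Nat.clog 2 q) ((exists_mem_edges_iff hl _).2 hxy)
    fun F hF => by
      refine le_trans ?_ (Nat.le_pow_clog one_lt_two _)
      rw [← hG.2.2.1 y hxy'.2]
      refine Finset.card_le_card fun x' hx' => ?_
      have := (exists_mem_edges_iff hl _).1 (hF x' hx')
      exact Finset.mem_filter.2 ⟨(Finset.mem_product.1 (G.edges_subset this)).1, this⟩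
  constructor <;> nlinarith

/-- Either `Y` is almost determined by `w` and `X` up to its private randomness, or `X` is one of
the few vertices with many neighbours of bounded complexity given `w`. -/
theorem IsOptimal.condC_le_or_condC_le (hU : IsOptimal U) (hA : Partrec₂ A) :
    ∃ c, ∀ (k d m M : ℕ) (G : BipartiteGraph Str Str), 1 ≤ d →
      G.BoundedCommonNeighborhoodRight d → (∃ l ∈ A k d, G.IsListedBy l) →
      k ≤ M → d ≤ M → m ≤ M →
      ∀ X Y w, CodeAdj (fun x y => (x, y) ∈ G.edges) m X Y → condC U Y w ≤ M →
        condC U Y (pair w X) ≤ m + c * (M.size + 1) ∨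
        condC U X w + 2 * condC U Y (pair X w) ≤
          2 * condC U Y w + m + Nat.clog 2 d + c * (M.size + 1) := by
  -- The parameters are ((k, d), (m, a)), where a bounds the complexity of the right vertex given w.
  let B : (((ℕ × ℕ) × (ℕ × ℕ)) × Str) × (Str × Str) → Prop := fun q =>
    CodeAdj (fun x y => ∃ l, l ∈ A q.1.1.1.1 q.1.1.1.2 ∧ (x, y) ∈ l.2.2) q.1.1.2.1 q.2.1 q.2.2 ∧
      condC U q.2.2 q.1.2 ≤ q.1.1.2.2
  have hB : Semidecidable B := by
    refine Semidecidable.and ?_ ?_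
    · let D := ((((ℕ × ℕ) × (ℕ × ℕ)) × Str) × (Str × Str)) × ((Str × Str) × (Str × Str))
      have e1 : Primrec fun p : D => p.2.1.1 := Primrec.fst.comp (Primrec.fst.comp Primrec.snd)
      have e2 : Primrec fun p : D => p.2.1.2 := Primrec.snd.comp (Primrec.fst.comp Primrec.snd)
      have e3 : Primrec fun p : D => p.2.2.1 := Primrec.fst.comp (Primrec.snd.comp Primrec.snd)
      have e4 : Primrec fun p : D => p.2.2.2 := Primrec.snd.comp (Primrec.snd.comp Primrec.snd)
      have e5 : Primrec fun p : D => p.1.2.1 := Primrec.fst.comp (Primrec.snd.comp Primrec.fst)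
      have e6 : Primrec fun p : D => p.1.2.2 := Primrec.snd.comp (Primrec.snd.comp Primrec.fst)
      have e7 : Primrec fun p : D => p.1.1.1 := Primrec.fst.comp (Primrec.fst.comp Primrec.fst)
      have e8 : Primrec fun p : D => p.1.1.1.1 := Primrec.fst.comp e7
      have e9 : Primrec fun p : D => p.1.1.1.2.1 := Primrec.fst.comp (Primrec.snd.comp e7)
      exact Semidecidable.ex (Semidecidable.and
        ((semidecidable_mem_edges hA).comp (e8.pair (e1.pair e3)))
        (Semidecidable.of_primrecPred (PrimrecPred.and
          (PrimrecPred.and (PrimrecRel.comp Primrec.eq e5 (primrec_pair.comp e1 e2))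
            (PrimrecRel.comp Primrec.eq e6 (primrec_pair.comp e3 e4)))
          (PrimrecPred.and (PrimrecRel.comp Primrec.eq (Primrec.list_length.comp e2) e9)
            (PrimrecRel.comp Primrec.eq (Primrec.list_length.comp e4) e9)))))
    · exact hU.semidecidable_condC_le.comp
        (((Primrec.snd.comp Primrec.snd).pair (Primrec.snd.comp Primrec.fst)).pair
          (Primrec.snd.comp (Primrec.snd.comp (Primrec.fst.comp Primrec.fst))))
  obtain ⟨c, hc⟩ := hU.exists_slice_size hB
  refine ⟨3 * c + 50, fun k d m M G hd hG hl hk hdM hm X Y w hXY hY => ?_⟩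
  set a := condC U Y w with ha
  have hBiff : ∀ X' Y', B ((((k, d), (m, a)), w), (X', Y')) ↔
      CodeAdj (fun x y => (x, y) ∈ G.edges) m X' Y' ∧ condC U Y' w ≤ a := by
    intro X' Y'
    simp only [B, exists_mem_edges_iff hl]
  obtain ⟨S, hS, hScard⟩ := hU.exists_finset_condC_le w a
  obtain ⟨j, hj1, hj2, ⟨F, hF, hFB⟩, hj3⟩ := hc ((k, d), (m, a)) w X Y ((hBiff _ _).2 ⟨hXY, le_rfl⟩)
    (S.finite_toSet.subset fun v' hv' => hS v' hv'.2)
  have hja : j ≤ a + 1 := by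
    refine (Nat.pow_le_pow_iff_right one_lt_two).1 (hF.trans ((Finset.card_le_card ?_).trans hScard))
    exact fun v' hv' => hS v' (hFB v' hv').2
  have hs1 : (Encodable.encode ((k, d), (m, a))).size ≤ 2 * (2 * M.size) := by
    simp only [Encodable.encode_prod_val, Encodable.encode_nat]
    exact size_pair_le (size_pair_le (Nat.size_le_size hk) (Nat.size_le_size hdM))
      (size_pair_le (Nat.size_le_size hm) (Nat.size_le_size hY))
  have hs2 : (Encodable.encode (((k, d), (m, a)), j)).size ≤ 2 * (4 * (M.size + 1)) := by
    rw [Encodable.encode_prod_val]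
    refine size_pair_le (hs1.trans (by omega)) ?_
    have := (Nat.size_le_size (hja.trans (Nat.succ_le_succ hY))).trans (size_succ_le M)
    simp only [Encodable.encode_nat]
    omega
  rcases Nat.lt_or_ge m j with hmj | hmj
  · right
    -- The exponent is that of |S|²·d·2^m, with |S| ≤ 2^(a+1), minus the 2j - 1 from the ordered
    -- pairs of dissimilar neighbours.
    have hcount : ∀ F : Finset Str, (∀ u' ∈ F, ∃ F' : Finset Str, 2 ^ j ≤ F'.card ∧
        ∀ v' ∈ F', B ((((k, d), (m, a)), w), (u', v'))) →
        F.card ≤ 2 ^ (2 * a + 3 + m + Nat.clog 2 d - 2 * j) := by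
      intro F hF
      have hmul := card_mul_two_pow_le_of_codeAdj hG hmj (F := F) (S := S) fun X hX => by
        obtain ⟨F', hF', h⟩ := hF X hX
        exact ⟨F', hF', fun Y hY => ⟨hS Y (h Y hY).2, ((hBiff _ _).1 (h Y hY)).1⟩⟩
      refine Nat.le_of_mul_le_mul_right (hmul.trans ?_)
        (show 0 < 2 ^ j * 2 ^ (j - 1) by positivity)
      calc S.card * S.card * (d * 2 ^ m)
          ≤ 2 ^ (a + 1) * 2 ^ (a + 1) * (2 ^ Nat.clog 2 d * 2 ^ m) := by
            gcongr
            exact Nat.le_pow_clog one_lt_two _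
        _ = 2 ^ (2 * a + 2 + m + Nat.clog 2 d) := by
            rw [← pow_add, ← pow_add, ← pow_add]; congr 1; omega
        _ ≤ _ := by
            rw [← pow_add, ← pow_add]
            exact Nat.pow_le_pow_right two_pos (by omega)
    have := hj3 _ hcount
    have h5 : 2 * a + 3 + m + Nat.clog 2 d - 2 * j + 2 * j ≤ 2 * a + 3 + m + Nat.clog 2 d + 2 := by
      omega
    nlinarith
  · left
    nlinarith

end Kolmogorov

namespace Kolmogorov

variable {U : Str → Str →. Str} {A : ℕ → ℕ →. List Str × List Str × List (Str × Str)}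

/-! ### The degenerate case q = 1 -/

/-- The only left vertex of a graph with `q = 1` is determined by `d`. -/
theorem IsOptimal.condC_le_size_of_one (hU : IsOptimal U) (hA : Partrec₂ A) :
    ∃ c, ∀ (d : ℕ) (G : BipartiteGraph Str Str), G.HasProfile 1 d →
      (∃ l ∈ A 0 d, G.IsListedBy l) → ∀ x ∈ G.left, ∀ z, condC U x z ≤ d.size + c := by
  -- The program is the plain binary expansion of d, not a self-delimiting code. As d is not
  -- controlled by N here, its length must enter with coefficient 1 to be covered by the term log d.
  let T : (Str × Str) × Str → Prop := fun q =>
    ∃ l, l ∈ A 0 (natOfBits q.1.1) ∧ l.1.head? = some q.2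
  have hT : Semidecidable T := by
    let D := ((Str × Str) × Str) × (List Str × List Str × List (Str × Str))
    have e1 : Primrec fun p : D => p.1.1.1 := Primrec.fst.comp (Primrec.fst.comp Primrec.fst)
    have e2 : Primrec fun p : D => p.1.2 := Primrec.snd.comp Primrec.fst
    have e3 : Primrec fun p : D => p.2 := Primrec.snd
    exact Semidecidable.ex (Semidecidable.and
      ((Semidecidable.of_partrec hA).comp
        (((Primrec.const 0).pair (primrec_natOfBits.comp e1)).pair e3))
      (Semidecidable.of_primrecPred (PrimrecRel.comp Primrec.eq
        (Primrec.list_head?.comp (Primrec.fst.comp e3)) (Primrec.option_some.comp e2))))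
  obtain ⟨V, hV, hVT⟩ := hT.exists_partrec fun a b b' => by
    rintro ⟨l, hl, h⟩ ⟨l', hl', h'⟩
    obtain rfl := Part.mem_unique hl hl'
    exact Option.some.inj (h.symm.trans h')
  obtain ⟨c, hc⟩ := hU.2 (fun p z => V (p, z)) hV
  refine ⟨c, fun d G hG hl x hx z => ?_⟩
  obtain ⟨l, hl, hL, -, -⟩ := hl
  have hcard : G.left.card = 1 := by simpa using hG.1
  obtain ⟨x₀, hx₀⟩ := Finset.card_eq_one.1 hcard
  have hall : ∀ x' ∈ l.1, x' = x := by
    intro x' hx'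
    have h1 : x' ∈ G.left := by rw [← hL]; simpa using hx'
    rw [hx₀, Finset.mem_singleton] at h1 hx
    rw [h1, hx]
  have hhead : l.1.head? = some x := by
    rw [← hL, List.mem_toFinset] at hx
    cases h : l.1 with
    | nil => simp [h] at hx
    | cons x' t => simp [hall x' (by simp [h])]
  obtain ⟨p, hp, hpl⟩ := hc d.bits x z (hVT _ _ ⟨l, by simpa only [natOfBits_bits] using hl, hhead⟩)
  rw [Nat.size_eq_bits_len] at hpl
  exact (condC_le_of_mem hp).trans hpl

/-! ### Logarithmic estimates -/

theorem size_le_logb_add_one {d : ℕ} (hd : 1 ≤ d) : (d.size : ℝ) ≤ Real.logb 2 d + 1 := by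
  have hpos : 0 < d.size := Nat.size_pos.2 hd
  have h : 2 ^ (d.size - 1) ≤ d := Nat.lt_size.1 (by omega)
  have h' : ((d.size - 1 : ℕ) : ℝ) ≤ Real.logb 2 d := by
    rw [Real.le_logb_iff_rpow_le one_lt_two (by exact_mod_cast hd), Real.rpow_natCast]
    exact_mod_cast h
  rw [Nat.cast_sub hpos] at h'
  push_cast at h'
  linarith

theorem clog_le_logb_add_one {d : ℕ} (hd : 1 ≤ d) : (Nat.clog 2 d : ℝ) ≤ Real.logb 2 d + 1 := by
  refine le_trans ?_ (size_le_logb_add_one hd)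
  exact_mod_cast Nat.clog_le_of_le_pow (Nat.lt_size_self d).le

theorem one_le_logScale (N : ℕ) : 1 ≤ logScale N := by
  rw [logScale, Real.le_logb_iff_rpow_le one_lt_two (by positivity)]
  have : (0 : ℝ) ≤ N := by positivity
  norm_num

theorem logScale_mono {N N' : ℕ} (h : N ≤ N') : logScale N ≤ logScale N' := by
  have h' : (N : ℝ) ≤ N' := by exact_mod_cast h
  exact Real.logb_le_logb_of_le one_lt_two (by positivity) (by linarith)

theorem logScale_le (N : ℕ) : logScale N ≤ N + 2 := by
  rw [logScale, Real.logb_le_iff_le_rpow one_lt_two (by positivity)]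
  have := (Nat.lt_two_pow_self (n := N + 2)).le
  have h : ((N + 2 : ℕ) : ℝ) ≤ (2 : ℝ) ^ (N + 2 : ℕ) := by exact_mod_cast this
  rw [← Real.rpow_natCast] at h
  simpa using h

theorem size_mul_le (a b : ℕ) : (a * b).size ≤ a.size + b.size := by
  rw [Nat.size_le, pow_add]
  exact Nat.mul_lt_mul'' (Nat.lt_size_self a) (Nat.lt_size_self b)

/-- Converts the error terms c·(M.size + 1), with M a fixed multiple of N + 2, into multiples of
`logScale N`. -/
theorem size_mul_add_one_le_logScale (a N : ℕ) :
    ((a * (N + 2)).size + 1 : ℝ) ≤ (a.size + 3) * logScale N := by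
  have h1 : ((a * (N + 2)).size : ℝ) ≤ a.size + (N + 2).size := by exact_mod_cast size_mul_le _ _
  have h2 : ((N + 2).size : ℝ) ≤ logScale N + 1 := by
    have := size_le_logb_add_one (d := N + 2) (by omega)
    simpa [logScale] using this
  have h3 := one_le_logScale N
  have h4 : (0 : ℝ) ≤ a.size := by positivity
  nlinarith

end Kolmogorov

/-! ### Proof of the theorem -/

open Kolmogorov in
/-- `U` is an optimal conditional decompressor, `A` is an algorithm that lists a graph given the
parameters `n` and `d`, and `c₀` is the constant in the definition of typicality. The constant
`c` of the `O(log N)` terms depends on these three only; `N` is the total length of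
`x, r_x, y, r_y, w`. -/
theorem theorem1 (U : Str → Str →. Str) (hU : IsOptimal U)
    (A : ℕ → ℕ →. List Str × List Str × List (Str × Str)) (hA : Partrec₂ A) (c₀ : ℝ) :
    ∃ c : ℝ, ∀ (q d m : ℕ) (G : BipartiteGraph Str Str), 1 ≤ d →
      G.HasProfile q d → G.BoundedCommonNeighborhoodRight d →
      (∃ l ∈ A (Nat.log 2 q) d, G.IsListedBy l) →
      ∀ xb yb : Str × List.Vector Bool m, IsTypicalEdge U c₀ G q d m xb yb →
      ∀ w : Str,
        (condC U yb.1 xb.1 : ℝ) ≤ condInfo U w (vertexCode yb) (vertexCode xb)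
            + c * logScale (vertexLength xb + vertexLength yb + w.length) ∨
        (condC U xb.1 yb.1 : ℝ) ≤ condInfo U (vertexCode xb) (vertexCode yb) w
            + condInfo U w (vertexCode xb) (vertexCode yb) + Real.logb 2 d
            + c * logScale (vertexLength xb + vertexLength yb + w.length) := by
  obtain ⟨cl, hcl⟩ := hU.condC_le_length
  obtain ⟨cp, hcp⟩ := hU.plainC_le_add primrec_pair
  -- With the arguments swapped, the same pair is described starting from Y instead of X.
  obtain ⟨cp', hcp'⟩ := hU.plainC_le_add primrec_pair.swap
  obtain ⟨cs, hcs⟩ := hU.condC_add_condC_le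
  obtain ⟨cn, hcn⟩ := hU.condC_neighbor_le hA
  obtain ⟨cd, hcd⟩ := hU.condC_le_or_condC_le hA
  obtain ⟨cw, hcw⟩ := hU.condC_pair_le
  obtain ⟨cq, hcq⟩ := hU.condC_le_size_of_one hA
  -- Chosen so that M = κ(N + 2) bounds all complexities of X and Y and, by typicality of Y, also (d
  -- + 1) log q when q ≥ 2.
  set κ : ℕ := 4 + cl + ⌈|c₀|⌉₊ with hκ
  refine ⟨2 + cq + 2 * |c₀| + (cn + cp + cp' + cs + cd + 2 * cw) * (κ.size + 3), ?_⟩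
  rintro q d m G hd hG hcommon hl xb yb ⟨hedge, htx, hty, htxy⟩ w
  set X := vertexCode xb with hX
  set Y := vertexCode yb with hY
  set N := vertexLength xb + vertexLength yb + w.length with hN
  set M := κ * (N + 2) with hM
  have hscale : 1 ≤ logScale N := one_le_logScale N
  have hL : (M.size + 1 : ℝ) ≤ (κ.size + 3) * logScale N := size_mul_add_one_le_logScale κ N
  have hL' : ∀ c : ℕ, (c : ℝ) * (M.size + 1) ≤ c * (κ.size + 3) * logScale N := fun c => by
    rw [mul_assoc]
    exact mul_le_mul_of_nonneg_left hL (Nat.cast_nonneg c)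
  have hE : c₀ * logScale (vertexLength xb + vertexLength yb) ≤ |c₀| * logScale N := by
    have h1 := one_le_logScale (vertexLength xb + vertexLength yb)
    have h2 : logScale (vertexLength xb + vertexLength yb) ≤ logScale N :=
      logScale_mono (Nat.le_add_right _ _)
    calc _ ≤ |c₀| * logScale (vertexLength xb + vertexLength yb) :=
          mul_le_mul_of_nonneg_right (le_abs_self c₀) (by linarith)
      _ ≤ _ := mul_le_mul_of_nonneg_left h2 (abs_nonneg c₀)
  obtain ⟨htx1, htx2⟩ := abs_le.1 (htx.trans hE)
  obtain ⟨hty1, hty2⟩ := abs_le.1 (hty.trans hE)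
  obtain ⟨htxy1, htxy2⟩ := abs_le.1 (htxy.trans hE)
  have hxy : (xb.1, yb.1) ∈ G.edges := (Finset.mem_filter.1 hedge).2
  have hxL : xb.1 ∈ G.left := (Finset.mem_product.1 (G.edges_subset hxy)).1
  have hXlen : X.length ≤ 2 * N + 2 := by
    rw [hX, vertexCode, length_pair, List.Vector.toList_length, hN, vertexLength, vertexLength]
    omega
  have hYlen : Y.length ≤ 2 * N + 2 := by
    rw [hY, vertexCode, length_pair, List.Vector.toList_length, hN, vertexLength, vertexLength]
    omega
  have hmN : m ≤ N := by
    rw [hN, vertexLength, vertexLength]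
    omega
  have hMlow : 2 * N + 2 + cl ≤ M := by
    rw [hM, hκ]
    nlinarith [Nat.zero_le (cl * N), Nat.zero_le (⌈|c₀|⌉₊ * N), Nat.zero_le ⌈|c₀|⌉₊]
  have hXC : ∀ z, condC U X z ≤ M := fun z => (hcl X z).2.trans (by omega)
  have hYC : ∀ z, condC U Y z ≤ M := fun z => (hcl Y z).2.trans (by omega)
  have hadj : CodeAdj (fun x y => (x, y) ∈ G.edges) m X Y :=
    ⟨((xb.1, xb.2.toList), (yb.1, yb.2.toList)), hxy, ⟨rfl, rfl⟩, by simp, by simp⟩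
  have hc_nonneg : ∀ c : ℕ, 0 ≤ (c : ℝ) * (κ.size + 3) * logScale N := fun c => by positivity
  have hcqN : (cq : ℝ) ≤ cq * logScale N := le_mul_of_one_le_right (Nat.cast_nonneg _) hscale
  have hcq0 : (0 : ℝ) ≤ cq := Nat.cast_nonneg _
  have hc₀N : 0 ≤ |c₀| * logScale N := mul_nonneg (abs_nonneg _) (by linarith)
  have hq0 : q ≠ 0 := by
    rintro rfl
    have : G.left.card = 0 := by simpa using hG.1
    rw [Finset.card_eq_zero.1 this] at hxL
    simp at hxL
  rcases Nat.lt_or_ge q 2 with hq | hq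
  -- Here x costs log d + O(1) bits, and both information terms are nonnegative up to O(log N),
  -- since extra conditions do not raise complexity.
  · obtain rfl : q = 1 := by omega
    right
    have h1 : (condC U xb.1 yb.1 : ℝ) ≤ d.size + cq := by
      exact_mod_cast hcq d G hG (by simpa using hl) xb.1 hxL yb.1
    have h2 := size_le_logb_add_one hd
    have h3 : (condC U Y (pair X w) : ℝ) ≤ condC U Y w + cw * (M.size + 1) := by
      exact_mod_cast hcw M Y X w (hYC w)
    have h4 : (condC U X (pair w Y) : ℝ) ≤ condC U X Y + cw * (M.size + 1) := by
      exact_mod_cast hcw M X w Y (hXC Y)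
    simp only [condInfo]
    linarith [hL' cw, hc_nonneg cn, hc_nonneg cp, hc_nonneg cp', hc_nonneg cs, hc_nonneg cd]
  · have hn1 : 1 ≤ Real.logb 2 q := by
      rw [Real.le_logb_iff_rpow_le one_lt_two (by positivity)]
      simpa using (by exact_mod_cast hq : (2 : ℝ) ≤ q)
    -- The lower typicality bound for C(Y) meets the trivial upper bound by length. As log q ≥ 1,
    -- both d and log q become at most M, so they can be described in O(log N) bits.
    have hdn : ((d : ℝ) + 1) * Real.logb 2 q ≤ M := by
      have h1 : (plainC U Y : ℝ) ≤ 2 * N + 2 + cl := by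
        exact_mod_cast (hcl Y []).2.trans (by omega)
      have h2 : |c₀| * logScale N ≤ ⌈|c₀|⌉₊ * ((N : ℝ) + 2) :=
        mul_le_mul (Nat.le_ceil _) (logScale_le N) (by linarith) (Nat.cast_nonneg _)
      have h3 : (M : ℝ) = (4 + cl + ⌈|c₀|⌉₊) * ((N : ℝ) + 2) := by
        rw [hM, hκ]; push_cast; ring
      have h4 : (0 : ℝ) ≤ m := Nat.cast_nonneg _
      have h5 : (0 : ℝ) ≤ N := Nat.cast_nonneg _
      have h6 : (0 : ℝ) ≤ cl := Nat.cast_nonneg _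
      have h7 : (0 : ℝ) ≤ cl * N := by positivity
      rw [h3]
      linarith
    have hd0 : (0 : ℝ) ≤ d := Nat.cast_nonneg _
    have hdM : d ≤ M := by
      have : (d : ℝ) ≤ M := by nlinarith
      exact_mod_cast this
    have hqM : Nat.log 2 q ≤ M := by
      have h1 : (Nat.log 2 q : ℝ) ≤ Real.logb 2 q := by
        rw [Real.le_logb_iff_rpow_le one_lt_two (by positivity), Real.rpow_natCast]
        exact_mod_cast Nat.pow_log_le_self 2 hq0
      have : (Nat.log 2 q : ℝ) ≤ M := by nlinarith
      exact_mod_cast this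
    obtain ⟨hn2, hn3⟩ := hcn q d M G hG hl hqM hdM xb.1 yb.1 hxy
    have hyx : (condC U yb.1 xb.1 : ℝ) ≤ d * Real.logb 2 q + 1 + cn * (M.size + 1) := by
      have h1 := clog_le_logb_add_one (d := q ^ d) (Nat.one_le_pow _ _ (by omega))
      rw [Nat.cast_pow, Real.logb_pow] at h1
      have h2 : (condC U yb.1 xb.1 : ℝ) ≤ Nat.clog 2 (q ^ d) + cn * (M.size + 1) := by
        exact_mod_cast hn2
      linarith
    have hxy' : (condC U xb.1 yb.1 : ℝ) ≤ Real.logb 2 q + 1 + cn * (M.size + 1) := by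
      have h1 := clog_le_logb_add_one (d := q) (by omega)
      have h2 : (condC U xb.1 yb.1 : ℝ) ≤ Nat.clog 2 q + cn * (M.size + 1) := by
        exact_mod_cast hn3
      linarith
    rcases hcd (Nat.log 2 q) d m M G hd hcommon hl hqM hdM (by omega) X Y w hadj (hYC w) with h | h
    · left
      -- Typicality turns this into C(Y|X) ≥ dn + m, and all but m of these bits are supplied by w.
      have h1 : (plainC U (pair X Y) : ℝ) ≤ plainC U X + condC U Y X + cp * (M.size + 1) := by
        exact_mod_cast hcp M X Y (hXC []) (hYC X)
      have h2 : (condC U Y (pair w X) : ℝ) ≤ m + cd * (M.size + 1) := by exact_mod_cast h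
      simp only [condInfo]
      linarith [hL' cn, hL' cp, hL' cd, hc_nonneg cp', hc_nonneg cs, hc_nonneg cw]
    · right
      -- Typicality turns this into C(X|Y) ≥ n + m. Adding `h2` and `h3` cancels C(X|w), and the m
      -- here cancels the m in `h2`.
      have h1 : (plainC U (pair X Y) : ℝ) ≤ plainC U Y + condC U X Y + cp' * (M.size + 1) := by
        exact_mod_cast hcp' M Y X (hYC []) (hXC Y)
      have h2 : (condC U X w : ℝ) + 2 * condC U Y (pair X w) ≤
          2 * condC U Y w + m + Nat.clog 2 d + cd * (M.size + 1) := by exact_mod_cast h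
      have h3 : (condC U Y w : ℝ) + condC U X (pair w Y) ≤
          condC U X w + condC U Y (pair X w) + cs * (M.size + 1) := by
        exact_mod_cast hcs M Y X w (hXC w) (hYC _)
      have h4 := clog_le_logb_add_one hd
      simp only [condInfo]
      linarith [hL' cn, hL' cp', hL' cd, hL' cs, hc_nonneg cp, hc_nonneg cw]
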